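/- Let $(K,v)$ be a valued field with value group $\Gamma=v(K^*)$ (a totally ordered abelian group, written additively), and let $\Gamma\hookrightarrow\Lambda$ be an extension of ordered abelian groups such that $\Gamma_{\mathbb Q}\subset\Lambda$ as an extension of $\Gamma$, where $\Gamma_{\mathbb Q}=\Gamma\otimes\mathbb Q$ is the divisible hull of $\Gamma$. Let $\mathcal T(\Lambda)$ be the set of all valuations $\mu\colon K[x]\to\Lambda\cup\{\infty\}$ whose restriction to $K$ is $v$, partially ordered by $\mu\le\nu$ if and only if $\mu(f)\le\nu(f)$ for all $f\in K[x]$. The support of $\mu$ is the prime ideal $\mathrm{supp}(\mu)=\mu^{-1}(\infty)$. A finite leaf of $\mathcal T(\Lambda)$ is a maximal element $\mu$ with $\mathrm{supp}(\mu)\neq 0$ (every $\mu\in\mathcal T(\Lambda)$ with nonzero support is in fact maximal); let $\mathcal L_{\rm fin}(\mathcal T(\Lambda))$ be the set of finite leaves. Let $\overline K$ be an algebraic closure of $K$, let $\bar v\colon\overline K\to\Gamma_{\mathbb Q}\cup\{\infty\}$ be a valuation extending $v$, and let $K^{\rm sep}$ be the separable closure of $K$ in $\overline K$. Let $K^h\subset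 K^{\rm sep}$ be the henselization of $K$ determined by $\bar v$, that is, the fixed field of the decomposition group $\{\sigma\in\mathrm{Aut}(K^{\rm sep}/K)\mid \sigma(\mathcal O)=\mathcal O\}$, where $\mathcal O$ is the valuation ring of $\bar v|_{K^{\rm sep}}$. For a field $L$ let $\mathrm{Irr}(L)$ be the set of monic irreducible polynomials in $L[x]$. Theorem. For every $F\in\mathrm{Irr}(K^h)$ there is a unique $N(F)\in\mathrm{Irr}(K)$ such that $(F\,K^h[x])\cap K[x]=N(F)K[x]$, and the formula $$w_F(g)=\bar v(g(\theta))\qquad\text{for all } g\in K[x],$$ where $\theta\in\overline K$ is a root of $F$, defines a finite leaf $w_F$ of $\mathcal T(\Lambda)$ which does not depend on the choice of the root $\theta$. We have $\mathrm{supp}(w_F)=N(F)K[x]$ and, for each root $\theta$ of $F$, the leaf $w_F$ is the composition $K[x]\to K[x]/(N(F))\xrightarrow{\ \bar v\circ\lambda_\theta\ }\Gamma_{\mathbb Q}\cup\{\infty\}\subset\Lambda\cup\{\infty\}$, where $\lambda_\theta\colon K[x]/(N(F))\to\overline K$ is the $K$-embedding sending the class of $x$ to $\theta$. The map $$\mathrm{Irr}(K^h)\longrightarrow\mathcal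 L_{\rm fin}(\mathcal T(\Lambda)),\qquad F\longmapsto w_F$$ is a bijection. -/

import Mathlib

open Polynomial

namespace ValTree

/-- `Irr L`: the set of monic irreducible polynomials over a field `L`. -/
abbrev Irr (L : Type*) [Field L] : Type _ :=
  {F : L[X] // F.Monic ∧ Irreducible F}

section Values

variable {A Γ Λ : Type*} [CommRing A]
  [AddCommGroup Γ] [LinearOrder Γ] [IsOrderedAddMonoid Γ]
  [AddCommGroup Λ] [LinearOrder Λ] [IsOrderedAddMonoid Λ]

/-- A `Γ ∪ {∞}`-valued valuation, regarded as a `Λ ∪ {∞}`-valued one by means of a homomorphism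
of ordered groups `Γ → Λ` (with `∞ ↦ ∞`). -/
noncomputable def changeValues (j : Γ →+o Λ) (μ : AddValuation A (WithTop Γ)) :
    AddValuation A (WithTop Λ) :=
  μ.map (AddMonoidHom.withTopMap (j : Γ →+ Λ)) rfl
    (WithTop.monotone_map_iff.mpr j.monotone')

theorem changeValues_apply (j : Γ →+o Λ) (μ : AddValuation A (WithTop Γ)) (a : A) :
    changeValues j μ a = (μ a).map j := rfl

end Values

section Tree

variable {K Γ Λ : Type*} [Field K]
  [AddCommGroup Γ] [LinearOrder Γ] [IsOrderedAddMonoid Γ]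
  [AddCommGroup Λ] [LinearOrder Λ] [IsOrderedAddMonoid Λ]

/-- The tree `𝒯(Λ)`: all valuations `μ : K[x] → Λ ∪ {∞}` whose restriction to `K` is `v`,
where `ι : Γ → Λ` is the given extension of ordered abelian groups. -/
def Tree (v : AddValuation K (WithTop Γ)) (ι : Γ →+o Λ) : Type _ :=
  {μ : AddValuation K[X] (WithTop Λ) // ∀ a : K, μ (C a) = (v a).map ι}

/-- The partial ordering of `𝒯(Λ)`: `μ ≤ ν` if and only if `μ f ≤ ν f` for all `f ∈ K[x]`. -/
noncomputable instance (v : AddValuation K (WithTop Γ)) (ι : Γ →+o Λ) : PartialOrder (Tree v ι) :=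
  PartialOrder.lift (fun μ (f : K[X]) => μ.1 f)
    (fun _ _ h => Subtype.ext (DFunLike.coe_injective h))

/-- The finite leaves of `𝒯(Λ)`: the maximal nodes with nontrivial support. -/
def FiniteLeaf (v : AddValuation K (WithTop Γ)) (ι : Γ →+o Λ) : Type _ :=
  {μ : Tree v ι // IsMax μ ∧ μ.1.supp ≠ ⊥}

/-- The valuation on `K[x]` underlying a finite leaf. -/
def FiniteLeaf.val {v : AddValuation K (WithTop Γ)} {ι : Γ →+o Λ} (μ : FiniteLeaf v ι) :
    AddValuation K[X] (WithTop Λ) :=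
  μ.1.1

/-- Maximality is automatic: every node with nontrivial support is a leaf. -/
theorem isMax_of_supp_ne_bot {v : AddValuation K (WithTop Γ)} {ι : Γ →+o Λ} (μ : Tree v ι)
    (h : μ.1.supp ≠ ⊥) : IsMax μ := by
  intro ν hν f
  have hle : ∀ g : K[X], μ.1 g ≤ ν.1 g := hν
  have hprime : μ.1.supp.IsPrime := by
    exact inferInstanceAs
      (Valuation.supp (AddValuation.toValuation μ.1)).IsPrime
  have hmax : μ.1.supp.IsMaximal := hprime.isMaximal h
  show ν.1 f ≤ μ.1 f
  by_cases hf : f ∈ μ.1.supp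
  · rw [AddValuation.mem_supp_iff] at hf
    rw [hf]
    exact le_top
  · obtain ⟨g, p, hp, hgp⟩ := hmax.exists_inv hf
    have hp' : μ.1 p = ⊤ := (AddValuation.mem_supp_iff _ _).1 hp
    have hq' : ν.1 p = ⊤ := top_le_iff.1 (hp' ▸ hle p)
    have key : ∀ ρ : AddValuation K[X] (WithTop Λ), ρ p = ⊤ → ρ g + ρ f = 0 := by
      intro ρ hρ
      have h1 : ρ (g * f) = 0 := by
        have e : g * f = 1 + -p := by rw [← hgp]; ring
        rw [e, AddValuation.map_add_eq_of_lt_left, AddValuation.map_one]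
        rw [AddValuation.map_one, AddValuation.map_neg, hρ]
        exact WithTop.coe_lt_top 0
      rw [← AddValuation.map_mul, h1]
    have e1 := key _ hp'
    have e2 := key _ hq'
    have hg := hle g
    generalize μ.1 g = a at *
    generalize ν.1 g = b at *
    generalize μ.1 f = c at *
    generalize ν.1 f = d at *
    induction a <;> induction b <;> induction c <;> induction d <;> simp_all
    norm_cast at *
    simp_all [add_eq_zero_iff_neg_eq]
    rw [← e1, ← e2]
    exact neg_le_neg hg

/-- The valuation on `K[x]` identified with a pair `(φ, ν)`, for `φ ∈ Irr K` and `ν` a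
`Γ' ∪ {∞}`-valued valuation on `K_φ = K[x]/(φ)`, where `Γ'` is embedded in `Λ` by `j`:
the composition `K[x] → K_φ → Γ' ∪ {∞} → Λ ∪ {∞}`. -/
noncomputable def ofPair {Γ' : Type*} [AddCommGroup Γ'] [LinearOrder Γ'] [IsOrderedAddMonoid Γ']
    (j : Γ' →+o Λ) (φ : Irr K) (ν : AddValuation (AdjoinRoot φ.1) (WithTop Γ')) :
    AddValuation K[X] (WithTop Λ) :=
  changeValues j (ν.comap (AdjoinRoot.mk φ.1))

end Tree

section Henselization

variable (K : Type*) {E Γ : Type*} [Field K] [Field E] [Algebra K E]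
  [AddCommGroup Γ] [LinearOrder Γ] [IsOrderedAddMonoid Γ]

/-- The restriction of a valuation `vbar` of `E` to the separable closure of `K` in `E`. -/
noncomputable def sepRestrict (vbar : AddValuation E (WithTop Γ)) :
    AddValuation (separableClosure K E) (WithTop Γ) :=
  vbar.comap (algebraMap (separableClosure K E) E)

/-- The decomposition group of the restriction of `vbar` to the separable closure `K^sep` of `K`
in `E`: the `K`-automorphisms of `K^sep` stabilizing the valuation ring of that restriction. -/
noncomputable def decompositionGroup (vbar : AddValuation E (WithTop Γ)) :
    Subgroup (separableClosure K E ≃ₐ[K] separableClosure K E) :=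
  (sepRestrict K vbar).toValuation.valuationSubring.decompositionSubgroup K

/-- The henselization `K^h ⊆ K^sep ⊆ E` of `K` determined by the valuation `vbar` of the algebraic
closure `E` of `K`: the fixed field of the decomposition group. -/
noncomputable def henselization (vbar : AddValuation E (WithTop Γ)) : IntermediateField K E :=
  IntermediateField.lift (IntermediateField.fixedField (decompositionGroup K vbar))

end Henselization

end ValTree

/-! A finite leaf has support generated by an irreducible `φ`, so it is an extension of `v` to
`K[x]/(φ)`. Embed this field in the algebraic closure and extend its valuation ring there. Valuation
rings of a normal extension over the same ring are conjugate (`exists_forall_mem_iff_of_normal`), so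
after an automorphism the ring is that of `vbar`. Since `Γ_ℚ` is torsion over `Γ`, the ring and the
values on `K` determine all values (`eq_map_of_nonneg_imp_nonneg`). Hence every finite leaf is `g ↦
vbar (g(θ))` for some `θ` (`exists_eq_evalValuation`).

By the same conjugacy over `K(θ')`, `θ` and `θ'` give the same leaf exactly when an automorphism
preserving the valuation ring of `vbar` carries one to the other. Such automorphisms are precisely
those fixing `K^h` (`forall_mem_henselization_iff`), so the leaf and the minimal polynomial of `θ`
over `K^h` determine each other. -/

/-! ### Conjugacy of valuation rings in normal extensions -/

namespace ValuationSubring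

/-- If `a` is the leading coefficient of `p`, then `a * x` is integral, hence equals some `c` in
`B`. If `a` is a unit in `W₁`, it is one in `W₂`, and `x = c / a` lies in `W₂`. Otherwise `c` is in
the maximal ideal of `W₁`, and replacing `a x^(n+1)` by `c x^n` lowers the degree while keeping a
coefficient that is a unit modulo that ideal. -/
theorem mem_of_aeval_eq_zero {B L : Type*} [CommRing B] [Field L] [Algebra B L]
    [IsIntegrallyClosedIn B L] (W₁ W₂ : ValuationSubring L)
    (h₂ : ∀ b : B, algebraMap B L b ∈ W₂)
    (hm : ∀ b : B, W₂.valuation (algebraMap B L b) < 1 → W₁.valuation (algebraMap B L b) < 1)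
    {x : L} (hx : x ∈ W₁) (n : ℕ) (p : B[X]) (hn : p.natDegree ≤ n) (hp : aeval x p = 0)
    (hc : ∃ i, ¬ W₁.valuation (algebraMap B L (p.coeff i)) < 1) : x ∈ W₂ := by
  induction n generalizing p with
  | zero =>
    obtain ⟨i, hi⟩ := hc
    refine (hi ?_).elim
    rw [Polynomial.eq_C_of_natDegree_le_zero hn] at hp ⊢
    rw [aeval_C] at hp
    rw [coeff_C]
    split_ifs <;> simp [hp]
  | succ n ih =>
    obtain hlt | heq := hn.lt_or_eq
    · exact ih p (Nat.lt_succ_iff.1 hlt) hp hc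
    obtain ⟨c, hcx⟩ : ∃ c : B, algebraMap B L c = p.leadingCoeff • x :=
      IsIntegrallyClosedIn.algebraMap_eq_of_integral (isIntegral_leadingCoeff_smul _ _ hp)
    have hcx' := hcx
    rw [Algebra.smul_def] at hcx
    by_cases ha : W₁.valuation (algebraMap B L p.leadingCoeff) < 1
    · have hc1 : W₁.valuation (algebraMap B L c) < 1 := by
        rw [hcx, map_mul]
        exact mul_lt_one_of_lt_of_le ha ((W₁.valuation_le_one_iff _).2 hx)
      have hmon : p.eraseLead + C p.leadingCoeff * X ^ (n + 1) = p := by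
        conv_rhs => rw [← eraseLead_add_C_mul_X_pow p, heq]
      refine ih (p.eraseLead + C c * X ^ n) ?_ ?_ ?_
      · refine natDegree_add_le_of_degree_le ?_ (natDegree_C_mul_X_pow_le _ _)
        have := eraseLead_natDegree_le p
        omega
      · rw [← hmon] at hp
        simp only [map_add, map_mul, aeval_C, map_pow, aeval_X] at hp ⊢
        rw [← hp, hcx, pow_succ]
        ring
      · obtain ⟨i, hi⟩ := hc
        have hin : i ≠ n + 1 := by
          rintro rfl
          rw [← heq] at hi
          exact hi ha
        refine ⟨i, fun h => hi ?_⟩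
        rw [coeff_add, eraseLead_coeff_of_ne _ (heq ▸ hin), coeff_C_mul, coeff_X_pow] at h
        split_ifs at h
        · have : algebraMap B L (p.coeff i) =
              algebraMap B L (p.coeff i + c * 1) - algebraMap B L c := by simp
          rw [this]
          exact (W₁.valuation.map_sub _ _).trans_lt (max_lt h hc1)
        · simpa using h
    · have h2 : ¬ W₂.valuation (algebraMap B L p.leadingCoeff) < 1 := fun h => ha (hm _ h)
      have h1 : W₂.valuation (algebraMap B L p.leadingCoeff) = 1 :=
        le_antisymm ((W₂.valuation_le_one_iff _).2 (h₂ _)) (not_lt.1 h2)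
      have := (W₂.valuation_le_one_iff _).2 (h₂ c)
      rw [hcx, map_mul, h1, one_mul] at this
      exact (W₂.valuation_le_one_iff _).1 this

theorem exists_aeval_eq_zero_of_isAlgebraic {K L : Type*} [Field K] [Field L] [Algebra K L]
    (A : ValuationSubring K) {x : L} (hx : IsAlgebraic K x) :
    ∃ p : A[X], aeval x p = 0 ∧ ∃ i, p.coeff i = 1 := by
  obtain ⟨p, hp0, hp⟩ := hx
  -- Dividing by a coefficient of largest multiplicative value makes all coefficients integral and
  -- one of them `1`.
  obtain ⟨i, hi, hmax⟩ := p.support.exists_max_image (fun i => A.valuation (p.coeff i))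
    (nonempty_support_iff.2 hp0)
  have hi0 : p.coeff i ≠ 0 := mem_support_iff.1 hi
  obtain ⟨q, hq⟩ := (mem_lifts (f := algebraMap A K) (C (p.coeff i)⁻¹ * p)).1 <| by
    rw [lifts_iff_coeff_lifts]
    intro n
    refine ⟨⟨(C (p.coeff i)⁻¹ * p).coeff n, (A.valuation_le_one_iff _).1 ?_⟩, rfl⟩
    rw [coeff_C_mul, map_mul, map_inv₀]
    by_cases hn : n ∈ p.support
    · exact inv_mul_le_one_of_le₀ (hmax n hn) zero_le
    · simp [notMem_support_iff.1 hn]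
  refine ⟨q, ?_, i, ?_⟩
  · rw [← aeval_map_algebraMap K, hq, map_mul, hp, mul_zero]
  · apply IsFractionRing.injective A K
    rw [← coeff_map, hq, coeff_C_mul, inv_mul_cancel₀ hi0, map_one]

/-- A valuation ring of an algebraic extension is determined by its center on the integral
closure. -/
theorem le_of_valuation_lt_one {K L : Type*} [Field K] [Field L] [Algebra K L]
    [Algebra.IsAlgebraic K L] (A : ValuationSubring K) (W₁ W₂ : ValuationSubring L)
    (h₂ : ∀ b : integralClosure A L, (b : L) ∈ W₂)
    (hm : ∀ b : integralClosure A L, W₂.valuation (b : L) < 1 → W₁.valuation (b : L) < 1) :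
    W₁ ≤ W₂ := by
  intro x hx
  obtain ⟨p, hp, i, hi⟩ := A.exists_aeval_eq_zero_of_isAlgebraic
    (Algebra.IsAlgebraic.isAlgebraic (R := K) x)
  refine mem_of_aeval_eq_zero W₁ W₂ h₂ hm hx _ (p.map (algebraMap A (integralClosure A L)))
    le_rfl (by rwa [aeval_map_algebraMap]) ⟨i, ?_⟩
  simp [coeff_map, hi]

theorem mem_of_isIntegral {K L : Type*} [Field K] [Field L] [Algebra K L]
    {A : ValuationSubring K} {W : ValuationSubring L} (h : W.comap (algebraMap K L) = A)
    {x : L} (hx : IsIntegral A x) : x ∈ W := by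
  obtain ⟨p, hp, hpx⟩ := hx
  have hA : ∀ a : A, algebraMap K L a ∈ W := fun a =>
    (SetLike.ext_iff.1 h (a : K)).2 a.2
  let f : A →+* W := ((algebraMap K L).comp A.subtype).codRestrict W.toSubring hA
  have : IsIntegral W x := by
    refine ⟨p.map f, hp.map f, ?_⟩
    rw [eval₂_map]
    exact hpx
  obtain ⟨y, rfl⟩ := IsIntegrallyClosed.algebraMap_eq_of_integral this
  exact y.2

theorem valuation_lt_one_iff_comap {K L : Type*} [Field K] [Field L] (f : K →+* L)
    (W : ValuationSubring L) (x : K) :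
    (W.comap f).valuation x < 1 ↔ W.valuation (f x) < 1 := by
  by_cases hx : x = 0
  · simp [hx]
  have hfx : f x ≠ 0 := by simpa using hx
  rw [← not_le, ← not_le, Valuation.one_le_val_iff _ hx, Valuation.one_le_val_iff _ hfx,
    valuation_le_one_iff, valuation_le_one_iff, mem_comap, map_inv₀]

-- Both rings have centers on the integral closure `B` of their common trace `A`, lying over the
-- same prime of `A`. The Galois group permutes such primes transitively, and the center determines
-- the ring.
open scoped Pointwise in
theorem exists_forall_mem_iff_of_isGalois {K L : Type*} [Field K] [Field L] [Algebra K L]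
    [IsGalois K L] (W₁ W₂ : ValuationSubring L)
    (h : W₁.comap (algebraMap K L) = W₂.comap (algebraMap K L)) :
    ∃ σ : Gal(L/K), ∀ x, σ x ∈ W₂ ↔ x ∈ W₁ := by
  obtain ⟨A, hA⟩ : ∃ A, W₁.comap (algebraMap K L) = A := ⟨_, rfl⟩
  have hA₂ := h.symm.trans hA
  let B := integralClosure A L
  have hact : ∀ (g : Gal(L/K)) (b : B), ((g • b : B) : L) = g b := fun _ _ => rfl
  have hinv : Algebra.IsInvariant A B Gal(L/K) := ⟨fun b hb => by
    obtain ⟨k, hk⟩ := (InfiniteGalois.mem_range_algebraMap_iff_fixed (k := K) (b : L)).2 fun g => by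
      rw [← hact, hb]
    have hint : IsIntegral A (algebraMap K L k) := by
      have := b.2
      rwa [← hk] at this
    rw [isIntegral_algebraMap_iff (algebraMap K L).injective] at hint
    obtain ⟨a, rfl⟩ := IsIntegrallyClosed.algebraMap_eq_of_integral hint
    exact ⟨a, Subtype.ext hk⟩⟩
  -- For infinite extensions, transitivity on primes needs a continuous action on discrete `B`: each
  -- element has an open stabilizer.
  let _ : TopologicalSpace B := ⊥
  have : DiscreteTopology B := ⟨rfl⟩
  have : ContinuousSMul Gal(L/K) B := (continuousSMul_iff_stabilizer_isOpen (X := B)).2 fun b => by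
    convert stabilizer_isOpen_of_isIntegral (K := K) (b : L) using 1
    ext g
    exact Subtype.ext_iff
  have center : ∀ W : ValuationSubring L, W.comap (algebraMap K L) = A →
      ∃ Q : Ideal B, Q.IsPrime ∧ ∀ b : B, b ∈ Q ↔ W.valuation (b : L) < 1 := fun W hW =>
    ⟨(IsLocalRing.maximalIdeal W).comap
      ((algebraMap B L).codRestrict W.toSubring fun b => mem_of_isIntegral hW b.2),
      inferInstance, fun b => W.valuation_lt_one_iff _⟩
  obtain ⟨Q₁, hp₁, hQ₁⟩ := center W₁ hA
  obtain ⟨Q₂, hp₂, hQ₂⟩ := center W₂ hA₂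
  have hunder : Q₁.under A = Q₂.under A := by
    ext a
    have e : (algebraMap A B a : L) = algebraMap K L a := rfl
    rw [Ideal.mem_comap, Ideal.mem_comap, hQ₁, hQ₂, e, ← valuation_lt_one_iff_comap,
      ← valuation_lt_one_iff_comap, h]
  obtain ⟨σ, hσ⟩ := Algebra.IsInvariant.exists_smul_of_under_eq_of_profinite
    (G := Gal(L/K)) Q₁ Q₂ hunder
  have key : ∀ b : B, (W₂.comap (σ : L →+* L)).valuation (b : L) < 1 ↔
      W₁.valuation (b : L) < 1 := fun b => by
    rw [valuation_lt_one_iff_comap, ← hQ₁, ← Ideal.smul_mem_pointwise_smul_iff (a := σ), ← hσ, hQ₂,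
      hact]
    rfl
  have hA₂' : (W₂.comap (σ : L →+* L)).comap (algebraMap K L) = A := by
    rw [← hA₂, comap_comap]
    congr 1
    exact (σ : L →ₐ[K] L).comp_algebraMap
  have : W₂.comap (σ : L →+* L) = W₁ := le_antisymm
    (le_of_valuation_lt_one A _ _ (fun b => mem_of_isIntegral hA b.2) fun b => (key b).2)
    (le_of_valuation_lt_one A _ _ (fun b => mem_of_isIntegral hA₂' b.2) fun b => (key b).1)
  exact ⟨σ, fun x => SetLike.ext_iff.1 this x⟩

theorem mem_of_pow_mem {L : Type*} [Field L] (W : ValuationSubring L) {x : L} {n : ℕ}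
    (hn : n ≠ 0) (h : x ^ n ∈ W) : x ∈ W := by
  rw [← valuation_le_one_iff, map_pow] at h
  rw [← valuation_le_one_iff]
  exact (pow_le_one_iff_of_nonneg zero_le hn).1 h

/-- Automorphisms compatible with valuation rings can be detected on the separable closure. -/
theorem forall_mem_iff_of_separableClosure {K E : Type*} [Field K] [Field E] [Algebra K E]
    [Algebra.IsAlgebraic K E] (W₁ W₂ : ValuationSubring E) (σ : Gal(E/K))
    (h : ∀ x : separableClosure K E, σ x ∈ W₂ ↔ (x : E) ∈ W₁) (x : E) : σ x ∈ W₂ ↔ x ∈ W₁ := by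
  -- Some power of `x` is separable over `K`, and a valuation ring contains `x` once it contains a
  -- positive power.
  obtain ⟨n, y, hy⟩ := IsPurelyInseparable.pow_mem (separableClosure K E)
    (ringExpChar (separableClosure K E)) x
  have hn : ringExpChar (separableClosure K E) ^ n ≠ 0 :=
    pow_ne_zero _ (expChar_pos (separableClosure K E) _).ne'
  have hy' : (y : E) = _ := hy
  have := h y
  rw [hy', map_pow] at this
  exact ⟨fun hx => W₁.mem_of_pow_mem hn (this.1 (pow_mem hx _)),
    fun hx => W₂.mem_of_pow_mem hn (this.2 (pow_mem hx _))⟩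

/-- The valuation rings of a normal extension lying over a fixed valuation ring are conjugate. -/
theorem exists_forall_mem_iff_of_normal {K E : Type*} [Field K] [Field E] [Algebra K E]
    [Normal K E] (W₁ W₂ : ValuationSubring E)
    (h : W₁.comap (algebraMap K E) = W₂.comap (algebraMap K E)) :
    ∃ σ : Gal(E/K), ∀ x, σ x ∈ W₂ ↔ x ∈ W₁ := by
  obtain ⟨τ, hτ⟩ := exists_forall_mem_iff_of_isGalois (K := K)
    (W₁.comap (algebraMap (separableClosure K E) E))
    (W₂.comap (algebraMap (separableClosure K E) E)) h
  obtain ⟨σ, rfl⟩ := AlgEquiv.restrictNormalHom_surjective (F := K) (K₁ := separableClosure K E) E τ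
  refine ⟨σ, forall_mem_iff_of_separableClosure W₁ W₂ σ fun x => ?_⟩
  rw [← show _ ↔ (x : E) ∈ W₁ from hτ x, mem_comap]
  exact iff_of_eq (congrArg (· ∈ W₂) (AlgEquiv.restrictNormal_commutes σ _ x).symm)

end ValuationSubring

/-! ### Values recovered from valuation rings -/

namespace ValTree

section Values

variable {K Γ Λ Γ' : Type*} [Field K]
  [AddCommGroup Γ] [LinearOrder Γ] [IsOrderedAddMonoid Γ]
  [AddCommGroup Γ'] [LinearOrder Γ'] [IsOrderedAddMonoid Γ']
  [AddCommGroup Λ] [LinearOrder Λ] [IsOrderedAddMonoid Λ]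

omit [IsOrderedAddMonoid Γ'] [IsOrderedAddMonoid Λ] in
theorem map_nonneg_iff (j : Γ' →+o Λ) (hj : Function.Injective j) (a : WithTop Γ') :
    0 ≤ a.map j ↔ 0 ≤ a := by
  induction a with
  | top => simp
  | coe a =>
    have : StrictMono j := j.monotone'.strictMono_of_injective hj
    rw [WithTop.map_coe, ← WithTop.coe_zero, WithTop.coe_le_coe, ← WithTop.coe_zero,
      WithTop.coe_le_coe, ← map_zero j, this.le_iff_le]

/-- A comparison of valuation rings yields a comparison of values. -/
theorem map_le_map_of_nonneg {M : Type*} [Field M]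
    (ν : AddValuation M (WithTop Λ)) (u : AddValuation M (WithTop Γ'))
    (h : ∀ y, 0 ≤ u y → 0 ≤ ν y) {y z : M} (hz : z ≠ 0) (hyz : u z ≤ u y) : ν z ≤ ν y := by
  have e : y = z * (y / z) := by field_simp
  have hu : 0 ≤ u (y / z) := by
    rw [e, AddValuation.map_mul] at hyz
    have hz' : u z ≠ ⊤ := (AddValuation.ne_top_iff u).2 hz
    exact (WithTop.add_le_add_iff_left hz').1 (by simpa using hyz)
  rw [e, AddValuation.map_mul]
  exact le_add_of_nonneg_right (h _ hu)

theorem exists_nsmul_eq_coe (q : DivisibleHull Γ) :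
    ∃ n : ℕ, n ≠ 0 ∧ ∃ γ : Γ, n • q = DivisibleHull.coeOrderAddMonoidHom Γ γ := by
  induction q with
  | mk m s =>
    refine ⟨s, s.ne_zero, m, ?_⟩
    rw [DivisibleHull.nsmul_mk]
    exact DivisibleHull.mk_eq_mk_iff_smul_eq_smul.2 (by simp)

theorem nsmul_injective_withTop {n : ℕ} (hn : n ≠ 0) {a b : WithTop Λ} (h : n • a = n • b) :
    a = b := by
  obtain ⟨m, rfl⟩ := Nat.exists_eq_succ_of_ne_zero hn
  induction a with
  | top =>
    induction b with
    | top => rfl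
    | coe b =>
      rw [succ_nsmul, add_top, ← WithTop.coe_nsmul] at h
      exact (WithTop.coe_ne_top h.symm).elim
  | coe a =>
    induction b with
    | top =>
      rw [succ_nsmul (⊤ : WithTop Λ), add_top, ← WithTop.coe_nsmul] at h
      exact (WithTop.coe_ne_top h).elim
    | coe b =>
      rw [← WithTop.coe_nsmul, ← WithTop.coe_nsmul, WithTop.coe_inj] at h
      rw [nsmul_right_injective hn h]

/-- Some power `y ^ n` has the same `u`-value as an element of `K`. The quotient is then a unit for
`u`, hence for `ν`, so the `ν`-values agree too, and division by `n` is unique in `Λ`. One inclusion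
of valuation rings is enough. -/
theorem eq_map_of_nonneg_imp_nonneg {v : AddValuation K (WithTop Γ)}
    (hv : ∀ γ : Γ, ∃ a : K, v a = (γ : WithTop Γ)) {ι : Γ →+o Λ} {j : DivisibleHull Γ →+o Λ}
    (hjι : ∀ γ : Γ, j (DivisibleHull.coeOrderAddMonoidHom Γ γ) = ι γ)
    {M : Type*} [Field M] (i : K →+* M)
    {ν : AddValuation M (WithTop Λ)} {u : AddValuation M (WithTop (DivisibleHull Γ))}
    (hν : ∀ a, ν (i a) = (v a).map ι)
    (hu : ∀ a, u (i a) = (v a).map (DivisibleHull.coeOrderAddMonoidHom Γ))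
    (h : ∀ y, 0 ≤ u y → 0 ≤ ν y) (y : M) : ν y = (u y).map j := by
  by_cases hy : y = 0
  · simp [hy]
  obtain ⟨q, hq⟩ := WithTop.ne_top_iff_exists.1 ((AddValuation.ne_top_iff u).2 hy)
  obtain ⟨n, hn, γ, hγ⟩ := exists_nsmul_eq_coe q
  obtain ⟨a, ha⟩ := hv γ
  have hua : u (i a) = u (y ^ n) := by
    rw [hu, ha, WithTop.map_coe, AddValuation.map_pow, ← hq, ← WithTop.coe_nsmul, hγ]
  have ha0 : i a ≠ 0 := by
    rw [← AddValuation.ne_top_iff u, hu, ha, WithTop.map_coe]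
    exact WithTop.coe_ne_top
  have hνa : ν (y ^ n) = ν (i a) := le_antisymm
    (map_le_map_of_nonneg ν u h (pow_ne_zero _ hy) hua.ge)
    (map_le_map_of_nonneg ν u h ha0 hua.le)
  apply nsmul_injective_withTop hn
  rw [← AddValuation.map_pow, hνa, hν, ha, ← hq, WithTop.map_coe, WithTop.map_coe,
    ← WithTop.coe_nsmul, ← map_nsmul, hγ, hjι]

theorem eq_of_nonneg_imp_nonneg {v : AddValuation K (WithTop Γ)}
    (hv : ∀ γ : Γ, ∃ a : K, v a = (γ : WithTop Γ))
    {M : Type*} [Field M] (i : K →+* M) {u₁ u₂ : AddValuation M (WithTop (DivisibleHull Γ))}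
    (h₁ : ∀ a, u₁ (i a) = (v a).map (DivisibleHull.coeOrderAddMonoidHom Γ))
    (h₂ : ∀ a, u₂ (i a) = (v a).map (DivisibleHull.coeOrderAddMonoidHom Γ))
    (h : ∀ y, 0 ≤ u₂ y → 0 ≤ u₁ y) (y : M) : u₁ y = u₂ y := by
  rw [eq_map_of_nonneg_imp_nonneg hv (j := OrderAddMonoidHom.id _) (fun _ => rfl) i h₁ h₂ h y]
  exact congrFun WithTop.map_id _

end Values

/-! ### Decomposition group and henselization -/

section Henselization

variable {K E Γ : Type*} [Field K] [Field E] [Algebra K E]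
  [AddCommGroup Γ] [LinearOrder Γ] [IsOrderedAddMonoid Γ]

open scoped Pointwise in
theorem mem_decompositionGroup_iff (vbar : AddValuation E (WithTop Γ))
    (σ : Gal(separableClosure K E/K)) :
    σ ∈ decompositionGroup K vbar ↔
      ∀ x : separableClosure K E, 0 ≤ vbar (σ x : separableClosure K E) ↔ 0 ≤ vbar (x : E) := by
  refine MulAction.mem_stabilizer_iff.trans ⟨fun h x => ?_, fun h => ?_⟩
  · have := ValuationSubring.smul_mem_pointwise_smul_iff (g := σ) (x := x)
      (S := (sepRestrict K vbar).toValuation.valuationSubring)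
    rw [h] at this
    exact this
  · ext x
    obtain ⟨x, rfl⟩ := MulAction.surjective σ x
    rw [ValuationSubring.smul_mem_pointwise_smul_iff]
    exact (h x).symm

/-- Closedness lets the infinite Galois correspondence recover the decomposition group from its
fixed field. Each defining condition depends only on `σ x`, hence is closed. -/
theorem isClosed_decompositionGroup (vbar : AddValuation E (WithTop Γ)) :
    IsClosed (decompositionGroup K vbar : Set Gal(separableClosure K E/K)) := by
  let _ : TopologicalSpace (separableClosure K E) := ⊥
  have : DiscreteTopology (separableClosure K E) := ⟨rfl⟩
  have : ContinuousSMul Gal(separableClosure K E/K) (separableClosure K E) :=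
    continuousSMul_iff_stabilizer_isOpen.2 fun b => stabilizer_isOpen_of_isIntegral b
  have : (decompositionGroup K vbar : Set Gal(separableClosure K E/K)) =
      ⋂ x : separableClosure K E, (fun σ => σ • x) ⁻¹'
        {y : separableClosure K E | 0 ≤ vbar (y : E) ↔ 0 ≤ vbar (x : E)} := by
    ext σ
    rw [SetLike.mem_coe, mem_decompositionGroup_iff, Set.mem_iInter]
    rfl
  rw [this]
  exact isClosed_iInter fun x => (isClosed_discrete _).preimage (by fun_prop)

/-- The automorphisms fixing the henselization are those preserving the valuation ring. -/
theorem forall_mem_henselization_iff [Normal K E] (vbar : AddValuation E (WithTop Γ))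
    (σ : Gal(E/K)) :
    (∀ x ∈ henselization K vbar, σ x = x) ↔ ∀ x, 0 ≤ vbar (σ x) ↔ 0 ≤ vbar x := by
  let S := separableClosure K E
  let τ : Gal(S/K) := σ.restrictNormal S
  have hτ : ∀ x : S, (τ x : E) = σ x := fun x => AlgEquiv.restrictNormal_commutes σ S x
  have h₁ : (∀ x ∈ henselization K vbar, σ x = x) ↔ τ ∈ decompositionGroup K vbar := by
    have := InfiniteGalois.fixingSubgroup_fixedField
      (⟨decompositionGroup K vbar, isClosed_decompositionGroup vbar⟩ : ClosedSubgroup Gal(S/K))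
    rw [← show _ = decompositionGroup K vbar from this, IntermediateField.mem_fixingSubgroup_iff]
    constructor
    · intro h x hx
      exact Subtype.ext ((hτ x).trans (h _ ((IntermediateField.mem_lift x).2 hx)))
    · intro h x hx
      have hxS : x ∈ S := IntermediateField.lift_le _ hx
      rw [← hτ ⟨x, hxS⟩]
      exact congrArg Subtype.val (h ⟨x, hxS⟩ ((IntermediateField.mem_lift ⟨x, hxS⟩).1 hx))
  rw [h₁, mem_decompositionGroup_iff]
  constructor
  · intro h
    refine ValuationSubring.forall_mem_iff_of_separableClosure (K := K)
      (AddValuation.toValuation vbar).valuationSubring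
      (AddValuation.toValuation vbar).valuationSubring σ fun x => ?_
    have := h x
    rwa [hτ] at this
  · intro h x
    rw [hτ]
    exact h x

end Henselization

end ValTree

/-! ### Conjugacy over the henselization -/

namespace ValTree

section Conjugation

variable {K E Γ : Type*} [Field K] [Field E] [Algebra K E]
  [AddCommGroup Γ] [LinearOrder Γ] [IsOrderedAddMonoid Γ]

/-- Two elements are conjugate over the henselization if and only if they are conjugate by an
automorphism preserving the valuation ring. -/
theorem isConjRoot_henselization_iff [Normal K E] (vbar : AddValuation E (WithTop Γ)) {θ θ' : E} :
    IsConjRoot (henselization K vbar) θ θ' ↔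
      ∃ σ : Gal(E/K), σ θ' = θ ∧ ∀ x, 0 ≤ vbar (σ x) ↔ 0 ≤ vbar x := by
  have : Normal (henselization K vbar) E := Normal.tower_top_of_normal K _ E
  rw [isConjRoot_iff_exists_algEquiv]
  constructor
  · rintro ⟨τ, hτ⟩
    refine ⟨τ.restrictScalars K, hτ, (forall_mem_henselization_iff vbar _).1 fun x hx => ?_⟩
    exact τ.commutes ⟨x, hx⟩
  · rintro ⟨σ, hσ, h⟩
    have hfix := (forall_mem_henselization_iff vbar σ).2 h
    exact ⟨AlgEquiv.ofRingEquiv (f := σ.toRingEquiv) fun x => hfix x x.2, hσ⟩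

/-- Elements at which polynomials take the same values are conjugate over the henselization. -/
theorem isConjRoot_henselization_of_eq [Normal K E] (vbar : AddValuation E (WithTop Γ)) {θ θ' : E}
    (h : ∀ g : K[X], vbar (aeval θ g) = vbar (aeval θ' g)) :
    IsConjRoot (henselization K vbar) θ θ' := by
  have hint : ∀ x : E, IsIntegral K x := Algebra.IsIntegral.isIntegral
  obtain ⟨σ, hσ⟩ : ∃ σ : Gal(E/K), σ θ' = θ := by
    rw [← isConjRoot_iff_exists_algEquiv]
    refine (isConjRoot_of_aeval_eq_zero (hint θ') ?_).symm
    rw [← AddValuation.top_iff vbar, h, minpoly.aeval, AddValuation.map_zero]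
  let O := (AddValuation.toValuation vbar).valuationSubring
  -- The hypothesis says that `O` and its pullback along `σ` agree on `K(θ')`. They are therefore
  -- conjugate by some `ρ` fixing `θ'`, and `σ ∘ ρ` preserves `O` and sends `θ'` to `θ`.
  have : Normal (IntermediateField.adjoin K {θ'}) E := Normal.tower_top_of_normal K _ E
  obtain ⟨ρ, hρ⟩ := ValuationSubring.exists_forall_mem_iff_of_normal
    (K := IntermediateField.adjoin K {θ'}) O (O.comap (σ : E →+* E)) <| by
      ext ⟨z, hz⟩
      obtain ⟨g, rfl⟩ : ∃ g : K[X], aeval θ' g = z := by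
        rwa [← IntermediateField.mem_toSubalgebra,
          IntermediateField.adjoin_simple_toSubalgebra_of_isAlgebraic (hint θ').isAlgebraic,
          Algebra.adjoin_singleton_eq_range_aeval] at hz
      change 0 ≤ vbar (aeval θ' g) ↔ 0 ≤ vbar (σ (aeval θ' g))
      rw [← h, ← hσ]
      exact iff_of_eq (congrArg (0 ≤ vbar ·) (aeval_algHom_apply (σ : E →ₐ[K] E) θ' g))
  refine (isConjRoot_henselization_iff vbar).2 ⟨(ρ.restrictScalars K).trans σ, ?_, hρ⟩
  rw [← hσ]
  exact congrArg σ (ρ.commutes ⟨θ', IntermediateField.mem_adjoin_simple_self K θ'⟩)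

end Conjugation

/-! ### Finite leaves as evaluations -/

section Leaves

variable {K Γ Λ E : Type*} [Field K]
  [AddCommGroup Γ] [LinearOrder Γ] [IsOrderedAddMonoid Γ]
  [AddCommGroup Λ] [LinearOrder Λ] [IsOrderedAddMonoid Λ]
  {v : AddValuation K (WithTop Γ)} {ι : Γ →+o Λ} {j : DivisibleHull Γ →+o Λ}
  [Field E] [Algebra K E] {vbar : AddValuation E (WithTop (DivisibleHull Γ))}

/-- Conjugate elements over the henselization give the same values. -/
theorem eq_of_isConjRoot_henselization [Normal K E]
    (hv : ∀ γ : Γ, ∃ a : K, v a = (γ : WithTop Γ))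
    (hvbar : ∀ a : K, vbar (algebraMap K E a) =
      (v a).map (DivisibleHull.coeOrderAddMonoidHom Γ)) {θ θ' : E}
    (h : IsConjRoot (henselization K vbar) θ θ') (g : K[X]) :
    vbar (aeval θ g) = vbar (aeval θ' g) := by
  obtain ⟨σ, rfl, hσ⟩ := (isConjRoot_henselization_iff vbar).1 h
  have := eq_of_nonneg_imp_nonneg hv (algebraMap K E) (u₁ := vbar.comap (σ : E →+* E)) (u₂ := vbar)
    (fun a => (congrArg vbar (σ.commutes a)).trans (hvbar a)) hvbar (fun y => (hσ y).2)
    (aeval θ' g)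
  rw [← this]
  exact congrArg vbar (aeval_algHom_apply (σ : E →ₐ[K] E) θ' g)

/-- Evaluation of `vbar` at `θ`, as a valuation on polynomials. -/
noncomputable def evalValuation (j : DivisibleHull Γ →+o Λ)
    (vbar : AddValuation E (WithTop (DivisibleHull Γ))) (θ : E) :
    AddValuation K[X] (WithTop Λ) :=
  changeValues j (vbar.comap (aeval θ : K[X] →ₐ[K] E).toRingHom)

theorem evalValuation_apply (θ : E) (g : K[X]) :
    evalValuation j vbar θ g = (vbar (aeval θ g)).map j := rfl

theorem evalValuation_eq_top_iff {θ : E} {g : K[X]} :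
    evalValuation j vbar θ g = ⊤ ↔ aeval θ g = 0 := by
  rw [evalValuation_apply, WithTop.map_eq_top_iff, AddValuation.top_iff]

theorem supp_evalValuation (θ : E) :
    (evalValuation j vbar θ).supp = Ideal.span {minpoly K θ} := by
  ext g
  rw [AddValuation.mem_supp_iff, evalValuation_eq_top_iff, Ideal.mem_span_singleton,
    minpoly.dvd_iff]

/-- The finite leaf attached to an algebraic element `θ`. -/
noncomputable def evalLeaf [Algebra.IsIntegral K E]
    (hjι : ∀ γ : Γ, j (DivisibleHull.coeOrderAddMonoidHom Γ γ) = ι γ)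
    (hvbar : ∀ a : K, vbar (algebraMap K E a) =
      (v a).map (DivisibleHull.coeOrderAddMonoidHom Γ)) (θ : E) : FiniteLeaf v ι :=
  let μ : Tree v ι := ⟨evalValuation j vbar θ, fun a => by
    rw [evalValuation_apply, aeval_C, hvbar]
    cases v a with
    | top => rfl
    | coe γ => exact congrArg _ (hjι γ)⟩
  have hμ : μ.1.supp ≠ ⊥ := by
    rw [supp_evalValuation, Ne, Ideal.span_singleton_eq_bot]
    exact minpoly.ne_zero (Algebra.IsIntegral.isIntegral θ)
  ⟨μ, isMax_of_supp_ne_bot μ hμ, hμ⟩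

/-- Every finite leaf comes from evaluation at an algebraic element. -/
theorem exists_eq_evalValuation [IsAlgClosed E] [Normal K E]
    (hv : ∀ γ : Γ, ∃ a : K, v a = (γ : WithTop Γ)) (hj : Function.Injective j)
    (hjι : ∀ γ : Γ, j (DivisibleHull.coeOrderAddMonoidHom Γ γ) = ι γ)
    (hvbar : ∀ a : K, vbar (algebraMap K E a) =
      (v a).map (DivisibleHull.coeOrderAddMonoidHom Γ)) (μ : FiniteLeaf v ι) :
    ∃ θ : E, μ.val = evalValuation j vbar θ := by
  have hsupp : μ.val.supp ≠ ⊥ := μ.2.2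
  have hprime : μ.val.supp.IsPrime :=
    inferInstanceAs (Valuation.supp (AddValuation.toValuation μ.val)).IsPrime
  let φ := Submodule.IsPrincipal.generator μ.val.supp
  have hφ : Irreducible φ :=
    (Submodule.IsPrincipal.prime_generator_of_isPrime μ.val.supp hsupp).irreducible
  have : Fact (Irreducible φ) := ⟨hφ⟩
  obtain ⟨θ, hθ⟩ := IsAlgClosed.exists_aeval_eq_zero E φ hφ.degree_pos.ne'
  let lam : AdjoinRoot φ →+* E := AdjoinRoot.lift (algebraMap K E) θ hθ
  have hlam : ∀ g, lam (AdjoinRoot.mk φ g) = aeval θ g := AdjoinRoot.lift_mk hθ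
  let ν : AddValuation (AdjoinRoot φ) (WithTop Λ) :=
    μ.val.onQuot (Ideal.span_singleton_generator μ.val.supp).le
  have hν : ∀ g, ν (AdjoinRoot.mk φ g) = μ.val g := fun g => rfl
  have hνK : ∀ a, ν (AdjoinRoot.of φ a) = (v a).map ι := fun a => μ.1.2 a
  let V := (AddValuation.toValuation ν).valuationSubring
  -- `W` dominates the image of `V`. If `y ∉ V`, then `y⁻¹` is a nonunit of `V`, so `lam y⁻¹` is a
  -- nonunit of `W` and `lam y ∉ W`: thus `W` pulls back exactly to `V`.
  obtain ⟨W, hW, hloc⟩ := IsLocalRing.exists_factor_valuationRing (lam.comp V.subtype)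
  have hVW : ∀ y, lam y ∈ W → 0 ≤ ν y := by
    intro y hy
    by_contra hyV
    have hy0 : y ≠ 0 := fun h => hyV (by simp [h])
    have hy' : y⁻¹ ∈ V := (V.mem_or_inv_mem y).resolve_left hyV
    have hunit : IsUnit ((lam.comp V.subtype).codRestrict W.toSubring hW ⟨y⁻¹, hy'⟩) :=
      .of_mul_eq_one (⟨lam y, hy⟩ : W.toSubring) <| Subtype.ext <| by
        change lam y⁻¹ * lam y = 1
        rw [← map_mul, inv_mul_cancel₀ hy0, map_one]
    obtain ⟨⟨z, hz⟩, hyz⟩ := (hloc.map_nonunit _ hunit).exists_right_inv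
    have hyz' : y⁻¹ * z = 1 := congrArg Subtype.val hyz
    rw [inv_mul_eq_one₀ hy0] at hyz'
    exact hyV (hyz' ▸ hz)
  have hι : Function.Injective ι := fun γ γ' h => by
    rw [← hjι, ← hjι] at h
    exact DivisibleHull.coe_injective (hj h)
  let O := (AddValuation.toValuation vbar).valuationSubring
  -- `W` and `O` both restrict to the valuation ring of `v` on `K`. The conjugating `σ` turns the
  -- root `θ` into the required `σ θ`.
  obtain ⟨σ, hσ⟩ := ValuationSubring.exists_forall_mem_iff_of_normal (K := K) W O <| by
    ext a
    have e : algebraMap K E a = lam (AdjoinRoot.of φ a) := (AdjoinRoot.lift_of hθ).symm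
    have h₁ : algebraMap K E a ∈ W ↔ 0 ≤ ν (AdjoinRoot.of φ a) := by
      rw [e]
      exact ⟨hVW _, fun h => hW ⟨_, h⟩⟩
    refine h₁.trans ?_
    rw [hνK, map_nonneg_iff ι hι]
    change _ ↔ 0 ≤ vbar _
    rw [hvbar, map_nonneg_iff _ DivisibleHull.coe_injective]
  refine ⟨σ θ, AddValuation.ext fun g => ?_⟩
  rw [← hν, eq_map_of_nonneg_imp_nonneg hv hjι (AdjoinRoot.of φ)
    (u := vbar.comap ((σ : E →+* E).comp lam)) hνK ?_ ?_, evalValuation_apply]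
  · congr 1
    change vbar (σ (lam _)) = _
    rw [hlam]
    exact congrArg vbar (aeval_algHom_apply (σ : E →ₐ[K] E) θ g).symm
  · intro a
    change vbar (σ (lam _)) = _
    rw [show lam (AdjoinRoot.of φ a) = algebraMap K E a from AdjoinRoot.lift_of hθ, σ.commutes, hvbar]
  · intro y hy
    exact hVW y ((hσ _).1 hy)

end Leaves

end ValTree

/-! ### The bijection -/

theorem theorem3p3
    {K : Type*} [Field K]
    {Γ : Type*} [AddCommGroup Γ] [LinearOrder Γ] [IsOrderedAddMonoid Γ]
    -- `v` is a valuation on `K` with value group `Γ`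
    (v : AddValuation K (WithTop Γ)) (hv : ∀ γ : Γ, ∃ a : K, v a = (γ : WithTop Γ))
    {Λ : Type*} [AddCommGroup Λ] [LinearOrder Λ] [IsOrderedAddMonoid Λ]
    -- `ι : Γ → Λ` is an extension of ordered abelian groups, and `Λ` contains `Γ_ℚ`
    (ι : Γ →+o Λ) (j : DivisibleHull Γ →+o Λ) (hj : Function.Injective j)
    (hjι : ∀ γ : Γ, j (DivisibleHull.coeOrderAddMonoidHom Γ γ) = ι γ)
    -- `Kbar` is an algebraic closure of `K`, and `vbar` is an extension of `v` to `Kbar`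
    {Kbar : Type*} [Field Kbar] [Algebra K Kbar] [IsAlgClosure K Kbar]
    (vbar : AddValuation Kbar (WithTop (DivisibleHull Γ)))
    (hvbar : ∀ a : K, vbar (algebraMap K Kbar a) =
      (v a).map (DivisibleHull.coeOrderAddMonoidHom Γ)) :
    ∃ (N : ValTree.Irr (ValTree.henselization K vbar) → ValTree.Irr K)
      (w : ValTree.Irr (ValTree.henselization K vbar) → ValTree.FiniteLeaf v ι),
      -- `N(F)` is determined by `(F K^h[x]) ∩ K[x] = N(F) K[x]`
      (∀ F, (Ideal.span {F.1}).comap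
          (Polynomial.mapRingHom (algebraMap K (ValTree.henselization K vbar))) =
        Ideal.span {(N F).1}) ∧
      -- `w_F(g) = vbar (g(θ))` for all `g`, and any root `θ` of `F`
      (∀ F, ∀ θ : Kbar, Polynomial.aeval θ F.1 = 0 →
        ∀ g : Polynomial K, (w F).val g = (vbar (Polynomial.aeval θ g)).map j) ∧
      -- `w_F = (N(F), vbar ∘ λ_θ)`, where `λ_θ : K[x]/(N(F)) → Kbar` sends the class of `x` to `θ`;
      -- the support of `w_F` is `N(F) K[x]`
      (∀ F, (w F).val.supp = Ideal.span {(N F).1}) ∧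
      (∀ F, ∀ θ : Kbar, Polynomial.aeval θ F.1 = 0 →
        ∃ lam : AdjoinRoot (N F).1 →ₐ[K] Kbar, lam (AdjoinRoot.root (N F).1) = θ ∧
          (w F).val = ValTree.ofPair j (N F) (vbar.comap (lam : AdjoinRoot (N F).1 →+* Kbar))) ∧
      Function.Bijective w := by
  have : IsAlgClosed Kbar := IsAlgClosure.isAlgClosed K
  have : Normal K Kbar := IsAlgClosure.normal K Kbar
  have hint : ∀ x : Kbar, IsIntegral K x := Algebra.IsIntegral.isIntegral
  have hintH : ∀ x : Kbar, IsIntegral (ValTree.henselization K vbar) x :=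
    Algebra.IsIntegral.isIntegral
  have hroot : ∀ F : ValTree.Irr (ValTree.henselization K vbar), ∃ θ : Kbar, aeval θ F.1 = 0 :=
    fun F => IsAlgClosed.exists_aeval_eq_zero Kbar F.1 F.2.2.degree_pos.ne'
  choose r hr using hroot
  have hmin : ∀ (F : ValTree.Irr (ValTree.henselization K vbar)) (θ : Kbar),
      aeval θ F.1 = 0 → F.1 = minpoly (ValTree.henselization K vbar) θ :=
    fun F θ h => minpoly.eq_of_irreducible_of_monic F.2.2 h F.2.1
  have hconj : ∀ (F : ValTree.Irr (ValTree.henselization K vbar)) (θ : Kbar),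
      aeval θ F.1 = 0 → IsConjRoot (ValTree.henselization K vbar) (r F) θ :=
    fun F θ h => (hmin F _ (hr F)).symm.trans (hmin F θ h)
  have hval : ∀ (F : ValTree.Irr (ValTree.henselization K vbar)) (θ : Kbar),
      aeval θ F.1 = 0 → ∀ g : K[X], ValTree.evalValuation j vbar (r F) g =
        (vbar (aeval θ g)).map j := fun F θ h g => by
    rw [ValTree.evalValuation_apply,
      ValTree.eq_of_isConjRoot_henselization hv hvbar (hconj F θ h) g]
  refine ⟨fun F => ⟨minpoly K (r F), minpoly.monic (hint _), minpoly.irreducible (hint _)⟩,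
    fun F => ValTree.evalLeaf hjι hvbar (r F), fun F => ?_, hval,
    fun F => ValTree.supp_evalValuation _, fun F θ hθ => ?_, fun F G hFG => ?_, fun μ => ?_⟩
  · ext g
    rw [Ideal.mem_comap, Ideal.mem_span_singleton, Ideal.mem_span_singleton, hmin F _ (hr F),
      minpoly.dvd_iff, minpoly.dvd_iff, coe_mapRingHom, aeval_map_algebraMap]
  -- The value `∞` at the chosen root `r F` transfers to the conjugate root `θ`.
  · have h0 : aeval θ (minpoly K (r F)) = 0 := by
      rw [← AddValuation.top_iff vbar,
        ← ValTree.eq_of_isConjRoot_henselization hv hvbar (hconj F θ hθ), minpoly.aeval,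
        AddValuation.map_zero]
    refine ⟨AdjoinRoot.liftAlgHom _ (Algebra.ofId K Kbar) θ h0, AdjoinRoot.liftAlgHom_root ..,
      AddValuation.ext fun g => ?_⟩
    refine (hval F θ hθ g).trans ?_
    refine congrArg (fun y => (vbar y).map j) (AdjoinRoot.liftAlgHom_mk _ _ _ h0 g).symm
  -- Injectivity of `j` turns equal leaves into equal `vbar`-values.
  · have : IsConjRoot (ValTree.henselization K vbar) (r F) (r G) :=
      ValTree.isConjRoot_henselization_of_eq vbar fun g =>
        WithTop.map_injective hj (DFunLike.congr_fun (congrArg ValTree.FiniteLeaf.val hFG) g)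
    exact Subtype.ext ((hmin F _ (hr F)).trans (Eq.trans this (hmin G _ (hr G)).symm))
  · obtain ⟨θ, hθ⟩ := ValTree.exists_eq_evalValuation (E := Kbar) hv hj hjι hvbar μ
    refine ⟨⟨minpoly _ θ, minpoly.monic (hintH θ), minpoly.irreducible (hintH θ)⟩,
      Subtype.ext (Subtype.ext (AddValuation.ext fun g => ?_))⟩
    refine (hval _ θ (minpoly.aeval _ _) g).trans ?_
    exact (DFunLike.congr_fun hθ g).symm
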